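/- Let $p$ be an odd prime and let $a$ be a positive integer. Then $$\sum_{k=0}^{p-1}(-1)^{(a-1)k}\binom{p-1}{k}^a\equiv 2^{a(p-1)}+\frac{a(a-1)(3a-4)}{48}\,p^3B_{p-3}\pmod{p^4},$$ where the Bernoulli numbers $B_n$ are given by $\frac{t}{e^t-1}=\sum_{n=0}^{\infty}\frac{B_n}{n!}t^n$, and where, for rational numbers $x,y$, the congruence $x\equiv y\pmod{p^4}$ means that $x-y=p^4z$ for some rational number $z$ whose reduced denominator is not divisible by $p$. -/

import Mathlib

/-- Congruence of rational numbers modulo a natural number `m`: the difference `x - y` is `m`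
times a rational number whose reduced denominator is coprime to `m`. For `m = p ^ 4` with `p`
prime this says that `x - y` lies in `p ^ 4 ℤ_(p)`, where `ℤ_(p)` is the ring of rational
numbers with denominator prime to `p`. -/
def RatModEq (m : ℕ) (x y : ℚ) : Prop :=
  ∃ z : ℚ, z.den.Coprime m ∧ x - y = (m : ℚ) * z

/-!
Put `c_k = (-1) ^ k * C(p - 1, k) = ∏_{j ≤ k} (1 - p / j)`, an integer congruent to `1` modulo `p`.
The sum in question is `S_a = ∑ (-1) ^ k c_k ^ a`. Expanding `c_k ^ a = (1 - (1 - c_k)) ^ a` modulo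
`p ^ 4` gives
`S_a ≡ 1 - a M_1 + C(a, 2) M_2 - C(a, 3) M_3`, with `M_i = ∑ (-1) ^ k (1 - c_k) ^ i`,
so `S_a` is determined by the three moments `M_1`, `M_2`, `M_3` (`sum_signedChoose_pow_mod`), and
these can be read off from `S_a` at three convenient exponents, `a = 1`, `2` and `-1`. Write
`Q = 2 ^ (p - 1)`, `m = (p - 1) / 2`, `H_s = ∑_{j ≤ m} 1 / j ^ s`, and let `p ≥ 5`.

* `S_1 = Q` by the binomial theorem, so `M_1 = 1 - Q`.
* `S_2 = c_m` exactly. Two product formulas for `c_m` give `c_m = Q ^ 2 ∏ (1 + p ^ 2 y_j)`, and with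
  `H_2 ≡ -(7 / 6) p H_3` modulo `p ^ 2` this is `Q ^ 2 - p ^ 3 H_3 / 24` (`signedChoose_half_mod`).
* `S_{-1} = ∑ 1 / C(p - 1, k) = 1 + p / 2 ^ p * ∑_{i < p} 2 ^ i / i` exactly, and
  `∑_{i ≤ p} (2 ^ i - 1) / i = ∑_{1 ≤ k ≤ p} C(p, k) / k` reduces the last sum to harmonic sums, which
  are all multiples of `H_3` to the required precision (`mul_twoPowSum_mod`, `moment_three`).

This yields `M_2 ≡ (Q - 1) ^ 2 - p ^ 3 H_3 / 24` and `M_3 ≡ -(Q - 1) ^ 3 + 3 p ^ 3 H_3 / 16`.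
The powers of `Q - 1` reassemble to `Q ^ a`, and `H_3 ≡ -2 B_{p-3}` modulo `p` (`harm_three_half`) gives the
Bernoulli term. The harmonic congruences all come from computing a sum over `1, …, p - 1` in two
ways: by pairing `j` with `p - j`, and by separating the even numbers from the odd ones, which are
`p` minus an even number (`two_splittings`). The prime `3` is treated by hand, because of the
denominators.
-/

open Finset

/-! ### Congruences between rational numbers -/

/-- The ring `ℤ_(p)` of rational numbers whose reduced denominator is prime to `p`. -/
def pIntegral (p : ℕ) : Subring ℚ where
  carrier := {x | x.den.Coprime p}
  mul_mem' {x y} hx hy := (Nat.Coprime.mul_left hx hy).coprime_dvd_left (Rat.mul_den_dvd x y)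
  add_mem' {x y} hx hy := (Nat.Coprime.mul_left hx hy).coprime_dvd_left (Rat.add_den_dvd x y)
  one_mem' := by simp
  zero_mem' := by simp
  neg_mem' {x} hx := by simpa using hx

@[simp, norm_cast]
lemma pIntegral.coe_ofNat (p k : ℕ) [k.AtLeastTwo] :
    ((ofNat(k) : pIntegral p) : ℚ) = ofNat(k) := rfl

/-- `PCong p n x y` says that `x ≡ y` modulo `p ^ n ℤ_(p)`; neither `x` nor `y` need be
`p`-integral. -/
def PCong (p n : ℕ) (x y : ℚ) : Prop :=
  ∃ z : pIntegral p, x - y = (p : ℚ) ^ n * z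

lemma RatModEq.of_pCong {p n : ℕ} {x y : ℚ} (h : PCong p n x y) : RatModEq (p ^ n) x y := by
  obtain ⟨⟨z, hz⟩, h⟩ := h
  exact ⟨z, Nat.Coprime.pow_right n hz, by push_cast; exact h⟩

namespace PCong

variable {p n : ℕ} {x y z x' y' : ℚ}

lemma refl (p n : ℕ) (x : ℚ) : PCong p n x x := ⟨0, by simp⟩

lemma of_eq (h : x = y) : PCong p n x y := h ▸ refl p n x

lemma symm (h : PCong p n x y) : PCong p n y x := by
  obtain ⟨a, h⟩ := h
  exact ⟨-a, by push_cast; linear_combination -h⟩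

lemma trans (h : PCong p n x y) (h' : PCong p n y z) : PCong p n x z := by
  obtain ⟨a, h⟩ := h
  obtain ⟨b, h'⟩ := h'
  exact ⟨a + b, by push_cast; linear_combination h + h'⟩

lemma add (h : PCong p n x y) (h' : PCong p n x' y') : PCong p n (x + x') (y + y') := by
  obtain ⟨a, h⟩ := h
  obtain ⟨b, h'⟩ := h'
  exact ⟨a + b, by push_cast; linear_combination h + h'⟩

lemma sub (h : PCong p n x y) (h' : PCong p n x' y') : PCong p n (x - x') (y - y') := by
  obtain ⟨a, h⟩ := h
  obtain ⟨b, h'⟩ := h'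
  exact ⟨a - b, by push_cast; linear_combination h - h'⟩

lemma mul_left (c : pIntegral p) (h : PCong p n x y) : PCong p n (c * x) (c * y) := by
  obtain ⟨a, h⟩ := h
  exact ⟨c * a, by push_cast; linear_combination (c : ℚ) * h⟩

lemma sum {ι : Type*} {s : Finset ι} {f g : ι → ℚ} (h : ∀ i ∈ s, PCong p n (f i) (g i)) :
    PCong p n (∑ i ∈ s, f i) (∑ i ∈ s, g i) := by
  classical
  induction s using Finset.induction_on with
  | empty => simpa using refl p n 0
  | insert a s ha ih =>
    rw [sum_insert ha, sum_insert ha]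
    exact (h a (mem_insert_self a s)).add (ih fun i hi => h i (mem_insert_of_mem hi))

end PCong

lemma natCast_inv_mem_pIntegral {p j : ℕ} (h : j.Coprime p) : (j : ℚ)⁻¹ ∈ pIntegral p := by
  rcases Nat.eq_zero_or_pos j with rfl | hj
  · simp
  · change ((j : ℚ)⁻¹).den.Coprime p
    rwa [Rat.inv_natCast_den_of_pos hj]

lemma inv_mem_pIntegral_of_lt {p j : ℕ} (hp : p.Prime) (h0 : 0 < j) (h : j < p) :
    (j : ℚ)⁻¹ ∈ pIntegral p :=
  natCast_inv_mem_pIntegral ((Nat.coprime_comm.1 (Nat.coprime_of_lt_prime h0.ne' h hp)))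

/-- Reflecting `j ↦ p - j` in the reciprocals: the geometric series of `1 / (p - j)`,
cut after its second term. -/
lemma inv_reflect {p j : ℕ} (hp : p.Prime) (h0 : 0 < j) (h : j < p) :
    PCong p 2 ((p - j : ℕ) : ℚ)⁻¹ (-(j : ℚ)⁻¹ - p * ((j : ℚ)⁻¹) ^ 2) := by
  lift (j : ℚ)⁻¹ to pIntegral p using inv_mem_pIntegral_of_lt hp h0 h with u hu
  lift ((p - j : ℕ) : ℚ)⁻¹ to pIntegral p using
    inv_mem_pIntegral_of_lt hp (by omega) (by omega) with w hw
  refine ⟨u ^ 2 * w, ?_⟩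
  push_cast
  rw [hu, hw, Nat.cast_sub h.le]
  have h1 : (j : ℚ) ≠ 0 := by positivity
  have h2 : (p : ℚ) - j ≠ 0 := sub_ne_zero.2 (by exact_mod_cast h.ne')
  field_simp
  ring

lemma inv_sq_reflect {p j : ℕ} (hp : p.Prime) (h0 : 0 < j) (h : j < p) :
    PCong p 2 (((p - j : ℕ) : ℚ)⁻¹ ^ 2) ((j : ℚ)⁻¹ ^ 2 + p * (2 * (j : ℚ)⁻¹ ^ 3)) := by
  obtain ⟨t, ht⟩ := inv_reflect hp h0 h
  lift (j : ℚ)⁻¹ to pIntegral p using inv_mem_pIntegral_of_lt hp h0 h with u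
  refine ⟨u ^ 4 + p ^ 2 * t ^ 2 - 2 * t * (u + p * u ^ 2), ?_⟩
  push_cast
  rw [eq_add_of_sub_eq ht]
  ring

/-! ### Splitting sums over `1, …, 2m` -/

/-- Pairing `j` with `2 m + 1 - j`. -/
lemma sum_range_two_mul_halves (f : ℕ → ℚ) (m : ℕ) :
    ∑ j ∈ range (2 * m), f (j + 1) =
      ∑ j ∈ range m, (f (j + 1) + f (2 * m + 1 - (j + 1))) := by
  rw [two_mul, sum_range_add, sum_add_distrib]
  congr 1
  rw [← sum_range_reflect]
  refine sum_congr rfl fun j hj => ?_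
  have := mem_range.1 hj
  congr 1
  omega

lemma sum_range_two_mul_pairs (f : ℕ → ℚ) (m : ℕ) :
    ∑ j ∈ range (2 * m), f j = ∑ j ∈ range m, (f (2 * j) + f (2 * j + 1)) := by
  induction m with
  | zero => simp
  | succ m ih => rw [mul_add_one, sum_range_succ, sum_range_succ, ih, sum_range_succ]; ring

/-- Separating the even numbers `2 j` from the odd numbers, written as `2 m + 1 - 2 j`. -/
lemma sum_range_two_mul_parity (f : ℕ → ℚ) (m : ℕ) :
    ∑ j ∈ range (2 * m), f (j + 1) =
      ∑ j ∈ range m, (f (2 * (j + 1)) + f (2 * m + 1 - 2 * (j + 1))) := by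
  rw [sum_range_two_mul_pairs (fun j => f (j + 1)), sum_add_distrib, sum_add_distrib, add_comm]
  congr 1
  rw [← sum_range_reflect]
  refine sum_congr rfl fun j hj => ?_
  have := mem_range.1 hj
  congr 1
  omega

/-- Both splittings of `1, …, p - 1` at once, for a function which is homogeneous under `j ↦ 2 j`
and whose reflection `f (p - j) ≡ f j + p g j` is known modulo `p ^ 2`. The two expressions for
the full sum determine it, and the half sum of `f`, in terms of the half sum of `g`. -/
lemma two_splittings {p m : ℕ} (hm : p = 2 * m + 1) {f g : ℕ → ℚ} {lam mu : ℚ}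
    (hf : ∀ j, f (2 * j) = lam * f j) (hg : ∀ j, g (2 * j) = mu * g j)
    (h : ∀ j, 0 < j → j < p → PCong p 2 (f (p - j)) (f j + p * g j)) :
    PCong p 2 (∑ j ∈ range (p - 1), f (j + 1))
        (2 * ∑ j ∈ range m, f (j + 1) + p * ∑ j ∈ range m, g (j + 1)) ∧
      PCong p 2 (∑ j ∈ range (p - 1), f (j + 1))
        (2 * lam * ∑ j ∈ range m, f (j + 1) + p * (mu * ∑ j ∈ range m, g (j + 1))) := by
  have h1 : p - 1 = 2 * m := by omega
  constructor
  · rw [h1, sum_range_two_mul_halves, ← hm]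
    refine (PCong.sum fun j hj => (PCong.refl p 2 _).add
      (h (j + 1) (by omega) (by have := mem_range.1 hj; omega))).trans (PCong.of_eq ?_)
    simp only [mul_sum, ← sum_add_distrib]
    exact sum_congr rfl fun j _ => by ring
  · rw [h1, sum_range_two_mul_parity, ← hm]
    refine (PCong.sum fun j hj => (PCong.refl p 2 _).add
      (h (2 * (j + 1)) (by omega) (by have := mem_range.1 hj; omega))).trans (PCong.of_eq ?_)
    simp only [mul_sum, ← sum_add_distrib, hf, hg]
    exact sum_congr rfl fun j _ => by ring

/-! ### Harmonic sums -/

/-- The generalized harmonic number `∑_{j = 1}^{n} 1 / j ^ s`. -/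
def harm (s n : ℕ) : ℚ := ∑ j ∈ range n, ((j + 1 : ℕ) : ℚ)⁻¹ ^ s

lemma harm_succ (s n : ℕ) : harm s (n + 1) = harm s n + ((n + 1 : ℕ) : ℚ)⁻¹ ^ s :=
  sum_range_succ _ _

lemma harm_mem_pIntegral {p n : ℕ} (hp : p.Prime) (s : ℕ) (hn : n < p) :
    harm s n ∈ pIntegral p :=
  sum_mem fun j hj => pow_mem (inv_mem_pIntegral_of_lt hp (by omega)
    (by have := mem_range.1 hj; omega)) s

lemma exists_coe_eq_inv {p j : ℕ} (hp : p.Prime) (h0 : 0 < j) (h : j < p) :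
    ∃ t : pIntegral p, (t : ℚ) = (j : ℚ)⁻¹ :=
  ⟨⟨_, inv_mem_pIntegral_of_lt hp h0 h⟩, rfl⟩

lemma inv_reflect_mod {p j : ℕ} (hp : p.Prime) (h0 : 0 < j) (h : j < p) :
    PCong p 1 ((p - j : ℕ) : ℚ)⁻¹ (-(j : ℚ)⁻¹) := by
  obtain ⟨a, h1⟩ := inv_reflect hp h0 h
  obtain ⟨u, hu⟩ := exists_coe_eq_inv hp h0 h
  exact ⟨p * a - u ^ 2, by push_cast; rw [hu]; linear_combination h1⟩

lemma inv_pow_three_reflect_mod {p j : ℕ} (hp : p.Prime) (h0 : 0 < j) (h : j < p) :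
    PCong p 1 (((p - j : ℕ) : ℚ)⁻¹ ^ 3) (-(j : ℚ)⁻¹ ^ 3) := by
  obtain ⟨a, h1⟩ := inv_reflect_mod hp h0 h
  obtain ⟨u, hu⟩ := exists_coe_eq_inv hp h0 h
  refine ⟨3 * u ^ 2 * a - 3 * u * p * a ^ 2 + p ^ 2 * a ^ 3, ?_⟩
  push_cast
  rw [eq_add_of_sub_eq h1, hu]
  ring

/-- The sum over `1, …, p - 1` of a function that is odd modulo `p` vanishes modulo `p`. -/
lemma sum_odd_mod {p m : ℕ} (hm : p = 2 * m + 1) {f : ℕ → ℚ}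
    (h : ∀ j, 0 < j → j < p → PCong p 1 (f (p - j)) (-f j)) :
    PCong p 1 (∑ j ∈ range (2 * m), f (j + 1)) 0 := by
  rw [sum_range_two_mul_halves, ← hm]
  refine (PCong.sum fun j hj => (PCong.refl p 1 _).add
    (h (j + 1) (by omega) (by have := mem_range.1 hj; omega))).trans (PCong.of_eq ?_)
  simp

lemma harm_one_mod {p m : ℕ} (hp : p.Prime) (hm : p = 2 * m + 1) :
    PCong p 1 (harm 1 (2 * m)) 0 := by
  refine sum_odd_mod hm (f := fun j => (j : ℚ)⁻¹ ^ 1) fun j h0 h => ?_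
  simpa using inv_reflect_mod hp h0 h

lemma harm_three_mod {p m : ℕ} (hp : p.Prime) (hm : p = 2 * m + 1) :
    PCong p 1 (harm 3 (2 * m)) 0 :=
  sum_odd_mod hm (f := fun j => (j : ℚ)⁻¹ ^ 3) fun _ h0 h => inv_pow_three_reflect_mod hp h0 h

/-- `two_splittings` for `1 / j ^ 2`: two independent relations between the full sum, the half sum
and `harm 3 m`. -/
lemma harm_two_splittings {p m : ℕ} (hp : p.Prime) (hm : p = 2 * m + 1) :
    PCong p 2 (harm 2 (2 * m)) (2 * harm 2 m + p * (2 * harm 3 m)) ∧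
      PCong p 2 (harm 2 (2 * m)) (2 * (1 / 4) * harm 2 m + p * (1 / 8 * (2 * harm 3 m))) := by
  have h := two_splittings hm (f := fun j => (j : ℚ)⁻¹ ^ 2) (g := fun j => 2 * (j : ℚ)⁻¹ ^ 3)
    (lam := 1 / 4) (mu := 1 / 8) (fun j => by push_cast; rw [mul_inv]; ring)
    (fun j => by push_cast; rw [mul_inv]; ring) fun j h0 h => inv_sq_reflect hp h0 h
  simp only [← mul_sum] at h
  rwa [show p - 1 = 2 * m by omega] at h

lemma harm_two_full {p m : ℕ} (hp : p.Prime) (hp5 : 5 ≤ p) (hm : p = 2 * m + 1) :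
    PCong p 2 (harm 2 (2 * m)) (-(1 / 3) * p * harm 3 m) := by
  obtain ⟨⟨a, ha⟩, b, hb⟩ := harm_two_splittings hp hm
  obtain ⟨t, ht⟩ := exists_coe_eq_inv (j := 3) hp (by omega) (by omega)
  refine ⟨t * (4 * b - a), ?_⟩
  push_cast at ht ⊢
  rw [ht]
  linear_combination 4 / 3 * hb - 1 / 3 * ha

lemma harm_two_half {p m : ℕ} (hp : p.Prime) (hp5 : 5 ≤ p) (hm : p = 2 * m + 1) :
    PCong p 2 (harm 2 m) (-(7 / 6) * p * harm 3 m) := by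
  obtain ⟨⟨a, ha⟩, b, hb⟩ := harm_two_splittings hp hm
  obtain ⟨t, ht⟩ := exists_coe_eq_inv (j := 3) hp (by omega) (by omega)
  refine ⟨t * (2 * (b - a)), ?_⟩
  push_cast at ht ⊢
  rw [ht]
  linear_combination 2 / 3 * hb - 2 / 3 * ha

/-- A refinement of Wolstenholme's theorem. -/
lemma harm_one_full {p m : ℕ} (hp : p.Prime) (hp5 : 5 ≤ p) (hm : p = 2 * m + 1) :
    PCong p 3 (harm 1 (2 * m)) (1 / 6 * p ^ 2 * harm 3 m) := by
  have h1 : 2 * harm 1 (2 * m) =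
      p * ∑ j ∈ range (2 * m), ((j + 1 : ℕ) : ℚ)⁻¹ * ((p - (j + 1) : ℕ) : ℚ)⁻¹ := by
    have : harm 1 (2 * m) = ∑ j ∈ range (2 * m), ((p - (j + 1) : ℕ) : ℚ)⁻¹ := by
      rw [harm, ← sum_range_reflect]
      refine sum_congr rfl fun j hj => ?_
      have := mem_range.1 hj
      rw [pow_one]
      congr 2
      omega
    rw [two_mul]
    nth_rw 2 [this]
    rw [harm, ← sum_add_distrib, mul_sum]
    refine sum_congr rfl fun j hj => ?_
    have hj := mem_range.1 hj
    have h2 : ((p - (j + 1) : ℕ) : ℚ) ≠ 0 := by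
      rw [Nat.cast_ne_zero]; omega
    have h3 : (p : ℚ) = ((j + 1 : ℕ) : ℚ) + ((p - (j + 1) : ℕ) : ℚ) := by
      rw [← Nat.cast_add]; congr 1; omega
    have h4 : ((j + 1 : ℕ) : ℚ) ≠ 0 := by positivity
    rw [h3, pow_one]
    field_simp
    ring
  have h2 : PCong p 2 (∑ j ∈ range (2 * m), ((j + 1 : ℕ) : ℚ)⁻¹ * ((p - (j + 1) : ℕ) : ℚ)⁻¹)
      (-harm 2 (2 * m) - p * harm 3 (2 * m)) := by
    have : -harm 2 (2 * m) - p * harm 3 (2 * m) = ∑ j ∈ range (2 * m),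
        ((j + 1 : ℕ) : ℚ)⁻¹ * (-((j + 1 : ℕ) : ℚ)⁻¹ - p * ((j + 1 : ℕ) : ℚ)⁻¹ ^ 2) := by
      rw [harm, harm, mul_sum, ← sum_neg_distrib, ← sum_sub_distrib]
      exact sum_congr rfl fun j _ => by ring
    rw [this]
    refine PCong.sum fun j hj => ?_
    have := mem_range.1 hj
    exact (inv_reflect hp (by omega) (by omega)).mul_left
      ⟨_, inv_mem_pIntegral_of_lt hp (by omega : 0 < j + 1) (by omega)⟩
  obtain ⟨a, ha⟩ := h2
  obtain ⟨b, hb⟩ := harm_three_mod hp hm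
  obtain ⟨c, hc⟩ := harm_two_full hp hp5 hm
  obtain ⟨t, ht⟩ := exists_coe_eq_inv (j := 2) hp (by omega) (by omega)
  refine ⟨t * (a - b - c), ?_⟩
  push_cast at ht ⊢
  rw [ht]
  linear_combination 1 / 2 * h1 + p / 2 * ha - p ^ 2 / 2 * hb - p / 2 * hc

/-- The harmonic numbers are symmetric under `k ↦ p - 1 - k` modulo `p`. -/
lemma harm_one_reflect {p k : ℕ} (hp : p.Prime) (hp2 : p ≠ 2) (hk : k < p) :
    PCong p 1 (harm 1 (p - 1 - k)) (harm 1 k) := by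
  obtain ⟨m, hm⟩ := hp.odd_of_ne_two hp2
  induction k with
  | zero =>
    rw [show p - 1 - 0 = 2 * m by omega]
    simpa [harm] using harm_one_mod hp hm
  | succ k ih =>
    have h := ih (by omega)
    rw [show p - 1 - k = p - 1 - (k + 1) + 1 by omega, harm_succ,
      show p - 1 - (k + 1) + 1 = p - (k + 1) by omega] at h
    have h1 := inv_reflect_mod hp (by omega : 0 < k + 1) hk
    have := h.sub h1
    rw [harm_succ]
    simpa using this

/-- The alternating sum is twice the sum over even `j` minus the full sum. -/
lemma alternating_harm (s m : ℕ) :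
    ∑ j ∈ range (2 * m), (-1 : ℚ) ^ (j + 1) * ((j + 1 : ℕ) : ℚ)⁻¹ ^ s =
      2 * (2 : ℚ)⁻¹ ^ s * harm s m - harm s (2 * m) := by
  rw [harm, harm, sum_range_two_mul_pairs, sum_range_two_mul_pairs, mul_sum, ← sum_sub_distrib]
  refine sum_congr rfl fun j _ => ?_
  have h : ((2 * j + 1 + 1 : ℕ) : ℚ)⁻¹ = 2⁻¹ * ((j + 1 : ℕ) : ℚ)⁻¹ := by
    rw [← mul_inv]; push_cast; ring
  have h1 : (-1 : ℚ) ^ (2 * j) = 1 := by simp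
  rw [h, mul_pow, pow_succ (-1) (2 * j + 1), pow_succ (-1) (2 * j), h1]
  ring

/-- An alternating double harmonic sum of odd weight, which the reflection `k ↦ p - k` reduces to a
single sum. -/
lemma alternating_harm_harm {p m : ℕ} (hp : p.Prime) (hp5 : 5 ≤ p) (hm : p = 2 * m + 1) :
    PCong p 1 (∑ j ∈ range (2 * m), (-1 : ℚ) ^ (j + 1) * ((j + 1 : ℕ) : ℚ)⁻¹ ^ 2 * harm 1 j)
      (-(1 / 8) * harm 3 m) := by
  set W := ∑ j ∈ range (2 * m), (-1 : ℚ) ^ (j + 1) * ((j + 1 : ℕ) : ℚ)⁻¹ ^ 2 * harm 1 j with hW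
  -- Under `k ↦ p - k` the sign changes, while `1 / k ^ 2` and `harm 1 (k - 1)` become
  -- `1 / k ^ 2` and `harm 1 k`.
  have h1 : PCong p 1 W (∑ j ∈ range (2 * m),
      (-1 : ℚ) ^ j * ((j + 1 : ℕ) : ℚ)⁻¹ ^ 2 * harm 1 (j + 1)) := by
    rw [hW, ← sum_range_reflect]
    refine PCong.sum fun j hj => ?_
    have hj := mem_range.1 hj
    rw [show 2 * m - 1 - j + 1 = p - (j + 1) by omega,
      show 2 * m - 1 - j = p - 1 - (j + 1) by omega]
    obtain ⟨a, ha⟩ := inv_sq_reflect hp (by omega : 0 < j + 1) (by omega)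
    obtain ⟨b, hb⟩ := harm_one_reflect hp (by omega) (by omega : j + 1 < p)
    obtain ⟨u, hu⟩ := exists_coe_eq_inv hp (by omega : 0 < j + 1) (by omega)
    lift harm 1 (j + 1) to pIntegral p using harm_mem_pIntegral hp 1 (by omega) with v
    have hs : (-1 : ℚ) ^ (p - (j + 1)) = (-1) ^ j := by
      rcases Nat.even_or_odd j with h | h
      · rw [h.neg_one_pow, Even.neg_one_pow]; rw [Nat.even_iff] at *; omega
      · rw [h.neg_one_pow, Odd.neg_one_pow]; rw [Nat.odd_iff] at *; omega
    rw [hs, eq_add_of_sub_eq ha, eq_add_of_sub_eq hb, ← hu]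
    refine ⟨(-1) ^ j * ((2 * u ^ 3 + p * a) * (v + p * b) + u ^ 2 * b), ?_⟩
    push_cast
    ring
  have h2 : ∑ j ∈ range (2 * m), (-1 : ℚ) ^ j * ((j + 1 : ℕ) : ℚ)⁻¹ ^ 2 * harm 1 (j + 1) =
      -W - ∑ j ∈ range (2 * m), (-1 : ℚ) ^ (j + 1) * ((j + 1 : ℕ) : ℚ)⁻¹ ^ 3 := by
    rw [hW, ← sum_neg_distrib, ← sum_sub_distrib]
    refine sum_congr rfl fun j _ => ?_
    rw [harm_succ]
    ring
  rw [h2, alternating_harm] at h1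
  obtain ⟨a, ha⟩ := h1
  obtain ⟨b, hb⟩ := harm_three_mod hp hm
  obtain ⟨t, ht⟩ := exists_coe_eq_inv (j := 2) hp (by omega) (by omega)
  refine ⟨t * (a + b), ?_⟩
  push_cast at ht ⊢
  rw [ht]
  linear_combination 1 / 2 * ha + 1 / 2 * hb

/-! ### The Bernoulli number -/

/-- The recursion for `bernoulli i` divides only by `i + 1`, so no prime `p > i + 1` enters the
denominator. -/
lemma bernoulli_mem_pIntegral {p i : ℕ} (hp : p.Prime) (hi : i + 1 < p) :
    bernoulli i ∈ pIntegral p := by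
  induction i using Nat.strong_induction_on with
  | _ i ih =>
    have h := sum_bernoulli (i + 1)
    rw [sum_range_succ, Nat.choose_succ_self_right] at h
    have h1 : bernoulli i = ((i + 1 : ℕ) : ℚ)⁻¹ * ((if i + 1 = 1 then 1 else 0) -
        ∑ k ∈ range i, ((i + 1).choose k : ℚ) * bernoulli k) := by
      rw [← h]
      have : ((i + 1 : ℕ) : ℚ) ≠ 0 := by positivity
      field_simp
      ring
    rw [h1]
    refine mul_mem (inv_mem_pIntegral_of_lt hp (by omega) hi) (sub_mem ?_ (sum_mem fun k hk => ?_))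
    · split_ifs
      exacts [one_mem _, zero_mem _]
    · have := mem_range.1 hk
      exact mul_mem (natCast_mem _ _) (ih k this (by omega))

/-- Faulhaber's formula modulo `p ^ 2`. -/
lemma sum_pow_eq_bernoulli {p s : ℕ} (hp : p.Prime) (h0 : 0 < s) (hs : s + 1 < p) :
    PCong p 2 (∑ j ∈ range (p - 1), ((j + 1 : ℕ) : ℚ) ^ s) (p * bernoulli s) := by
  have h1 : ∑ j ∈ range (p - 1), ((j + 1 : ℕ) : ℚ) ^ s = ∑ j ∈ range p, (j : ℚ) ^ s := by
    conv_rhs => rw [show p = p - 1 + 1 by omega, sum_range_succ']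
    simp [h0.ne']
  have hs1 : ((s : ℚ) + 1) ≠ 0 := by positivity
  obtain ⟨t, ht⟩ := exists_coe_eq_inv hp (by omega : 0 < s + 1) hs
  rw [h1, sum_range_pow, sum_range_succ, Nat.choose_succ_self_right, show s + 1 - s = 1 by omega]
  have h2 : PCong p 2 (∑ i ∈ range s, bernoulli i * ((s + 1).choose i) * (p : ℚ) ^ (s + 1 - i) /
      (s + 1)) 0 := by
    refine (PCong.sum (g := fun _ => 0) fun i hi => ?_).trans (PCong.of_eq (by simp))
    have hi := mem_range.1 hi
    obtain ⟨k, hk⟩ : ∃ k, s + 1 - i = k + 2 := ⟨s - 1 - i, by omega⟩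
    lift bernoulli i to pIntegral p using bernoulli_mem_pIntegral hp (by omega) with b
    refine ⟨b * (s + 1).choose i * p ^ k * t, ?_⟩
    push_cast at ht ⊢
    rw [ht, hk]
    field_simp
    ring
  have h3 := h2.add (PCong.refl p 2 (bernoulli s * ((s + 1 : ℕ) : ℚ) * (p : ℚ) ^ 1 / (s + 1)))
  refine h3.trans (PCong.of_eq ?_)
  push_cast
  field_simp
  ring

/-- The binomial expansion of `(p - j) ^ (p - 3)` modulo `p ^ 2`, in which `-(p - 3)` becomes `3`. -/
lemma pow_reflect {p s j : ℕ} (hs : Odd s) (hps : p = s + 4) (h : j < p) :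
    PCong p 2 (((p - j : ℕ) : ℚ) ^ (s + 1)) ((j : ℚ) ^ (s + 1) + p * (3 * (j : ℚ) ^ s)) := by
  obtain ⟨k, hk⟩ := Polynomial.powAddExpansion (-(j : pIntegral p)) (p : pIntegral p) (s + 1)
  have hk' := congrArg (Subtype.val) hk
  push_cast at hk'
  refine ⟨k - j ^ s, ?_⟩
  push_cast
  rw [Nat.cast_sub h.le]
  rw [hs.add_one.neg_pow, hs.neg_pow] at hk'
  have : (p : ℚ) = s + 4 := by exact_mod_cast hps
  rw [neg_add_eq_sub] at hk'
  linear_combination hk' + (j : ℚ) ^ s * p * this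

lemma exists_pow_sub_one {p j : ℕ} (hp : p.Prime) (h0 : 0 < j) (h : j < p) :
    ∃ k : pIntegral p, (j : ℚ) ^ (p - 1) = 1 + p * k := by
  have := (Nat.ModEq.pow_totient (Nat.coprime_of_lt_prime h0.ne' h hp).symm).dvd
  rw [Nat.totient_prime hp] at this
  obtain ⟨k, hk⟩ := this
  refine ⟨((-k : ℤ) : pIntegral p), ?_⟩
  have := congrArg (Int.cast : ℤ → ℚ) hk
  push_cast at this ⊢
  linear_combination -this

/-- The half sum of the inverse cubes is `-2 B_{p-3}` modulo `p`: both splittings of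
`∑ j ^ (p - 3) ≡ p B_{p-3}` are compared. -/
lemma harm_three_half {p m : ℕ} (hp : p.Prime) (hp5 : 5 ≤ p) (hm : p = 2 * m + 1) :
    PCong p 1 (harm 3 m) (-2 * bernoulli (p - 3)) := by
  obtain ⟨s, hs⟩ : ∃ s, p = s + 4 := ⟨p - 4, by omega⟩
  have hso : Odd s := by rw [Nat.odd_iff]; omega
  have hsplit := two_splittings hm (f := fun j => (j : ℚ) ^ (s + 1))
    (g := fun j => 3 * (j : ℚ) ^ s) (lam := 2 ^ (s + 1)) (mu := 2 ^ s)
    (fun j => by push_cast; ring) (fun j => by push_cast; ring) fun j _ h => pow_reflect hso hs h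
  simp only [← mul_sum] at hsplit
  obtain ⟨h1, h2⟩ := hsplit
  have hB := sum_pow_eq_bernoulli (s := s + 1) hp (by omega) (by omega)
  rw [show p - 3 = s + 1 by omega]
  obtain ⟨a, ha⟩ := hB.symm.trans h1
  obtain ⟨b, hb⟩ := hB.symm.trans h2
  -- Fermat's little theorem replaces `j ^ (p - 4)` by `1 / j ^ 3`.
  have hG : PCong p 1 (∑ j ∈ range m, ((j + 1 : ℕ) : ℚ) ^ s) (harm 3 m) := by
    refine PCong.sum fun j hj => ?_
    have hj := mem_range.1 hj
    obtain ⟨u, hu⟩ := exists_coe_eq_inv hp (by omega : 0 < j + 1) (by omega)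
    obtain ⟨k, hk⟩ := exists_pow_sub_one hp (by omega : 0 < j + 1) (by omega)
    have h4 : ((j + 1 : ℕ) : ℚ) ^ s = ((j + 1 : ℕ) : ℚ) ^ (p - 1) * ((j + 1 : ℕ) : ℚ)⁻¹ ^ 3 := by
      have : ((j + 1 : ℕ) : ℚ) ≠ 0 := by positivity
      rw [show p - 1 = s + 3 by omega, pow_add]
      field_simp
    refine ⟨k * u ^ 3, ?_⟩
    rw [h4, hk]
    push_cast at hu ⊢
    rw [hu]
    ring
  obtain ⟨c, hc⟩ := hG
  obtain ⟨k, hk⟩ := exists_pow_sub_one (j := 2) hp (by omega) (by omega)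
  obtain ⟨t, ht⟩ := exists_coe_eq_inv (j := 3) hp (by omega) (by omega)
  lift bernoulli (s + 1) to pIntegral p using bernoulli_mem_pIntegral hp (by omega) with B
  set P := ∑ j ∈ range m, ((j + 1 : ℕ) : ℚ) ^ (s + 1)
  set G := ∑ j ∈ range m, ((j + 1 : ℕ) : ℚ) ^ s with hGdef
  obtain ⟨G', hG'⟩ : ∃ G' : pIntegral p, (G' : ℚ) = G :=
    ⟨⟨G, sum_mem fun j _ => pow_mem (natCast_mem _ _) s⟩, rfl⟩
  have hp0 : (p : ℚ) ≠ 0 := by exact_mod_cast hp.ne_zero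
  have hk8 : (2 : ℚ) ^ s * 8 = 1 + p * k := by
    rw [← Nat.cast_ofNat (R := ℚ) (n := 2), ← hk, show p - 1 = s + 3 by omega, pow_add]; norm_num
  refine ⟨t * (8 * b - 2 * a + 2 * k * (B - 3 * G' - p * a) + 3 * k * G') - c, ?_⟩
  push_cast at ht ⊢
  rw [ht, hG']
  apply mul_left_cancel₀ hp0
  linear_combination 8 / 3 * hb - 2 / 3 * ha - 2 / 3 * p * k * ha + (4 * P + 3 * p * G) / 3 * hk8 -
    p * hc

/-! ### Signed binomial coefficients -/

/-- The integer `(-1) ^ k * C(p - 1, k)`, as a rational number; it is `∏_{j ≤ k} (1 - p / j)` for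
`k < p`. -/
def signedChoose (p k : ℕ) : ℚ := (-1) ^ k * ((p - 1).choose k : ℚ)

lemma signedChoose_succ {p k : ℕ} (hk : k + 1 < p) :
    signedChoose p (k + 1) = signedChoose p k * (1 - p * ((k + 1 : ℕ) : ℚ)⁻¹) := by
  have h := congrArg (Nat.cast : ℕ → ℚ) (Nat.choose_succ_right_eq (p - 1) k)
  rw [Nat.cast_mul, Nat.cast_mul, Nat.cast_sub (by omega), Nat.cast_sub (by omega)] at h
  have h1 : ((k + 1 : ℕ) : ℚ) ≠ 0 := by positivity
  rw [signedChoose, signedChoose, pow_succ]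
  field_simp
  push_cast at h ⊢
  linear_combination -h

lemma signedChoose_eq_prod {p k : ℕ} (hk : k < p) :
    signedChoose p k = ∏ j ∈ range k, (1 - p * ((j + 1 : ℕ) : ℚ)⁻¹) := by
  induction k with
  | zero => simp [signedChoose]
  | succ k ih => rw [prod_range_succ, ← ih (by omega), signedChoose_succ hk]

lemma signedChoose_mod {p k : ℕ} (hp : p.Prime) (hk : k < p) :
    PCong p 2 (signedChoose p k) (1 - p * harm 1 k) := by
  induction k with
  | zero => exact PCong.of_eq (by simp [signedChoose, harm])
  | succ k ih =>
    obtain ⟨a, ha⟩ := ih (by omega)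
    obtain ⟨u, hu⟩ := exists_coe_eq_inv hp (by omega : 0 < k + 1) hk
    rw [signedChoose_succ hk, harm_succ, eq_add_of_sub_eq ha]
    lift harm 1 k to pIntegral p using harm_mem_pIntegral hp 1 (by omega) with v
    refine ⟨a * (1 - p * u) + u * v, ?_⟩
    rw [← hu]
    push_cast
    ring

lemma exists_signedChoose_eq {p k : ℕ} (hp : p.Prime) (hk : k < p) :
    ∃ z : pIntegral p, signedChoose p k = 1 + p * z := by
  obtain ⟨a, ha⟩ := signedChoose_mod hp hk
  lift harm 1 k to pIntegral p using harm_mem_pIntegral hp 1 hk with v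
  exact ⟨p * a - v, by push_cast; linear_combination ha⟩

lemma signedChoose_ne_zero {p k : ℕ} (hk : k < p) : signedChoose p k ≠ 0 :=
  mul_ne_zero (pow_ne_zero _ (by norm_num))
    (Nat.cast_ne_zero.2 (Nat.choose_pos (by omega)).ne')

lemma signedChoose_inv_mem_pIntegral {p k : ℕ} (hp : p.Prime) (hk : k < p) :
    (signedChoose p k)⁻¹ ∈ pIntegral p := by
  rw [signedChoose, mul_inv, ← inv_pow]
  refine mul_mem (pow_mem (by norm_num) k) (natCast_inv_mem_pIntegral ?_)
  rw [Nat.coprime_comm, hp.coprime_iff_not_dvd]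
  intro h
  have h1 : (p - 1).choose k ∣ (p - 1).factorial :=
    ⟨_, by rw [← mul_assoc, Nat.choose_mul_factorial_mul_factorial (by omega)]⟩
  have := hp.dvd_factorial.1 (h.trans h1)
  have := hp.pos
  omega

lemma sum_signedChoose {p : ℕ} (hp : 0 < p) :
    ∑ k ∈ range p, (-1 : ℚ) ^ k * signedChoose p k = 2 ^ (p - 1) := by
  obtain ⟨n, rfl⟩ : ∃ n, p = n + 1 := ⟨p - 1, by omega⟩
  have h := congrArg (Nat.cast : ℕ → ℚ) (Nat.sum_range_choose n)
  push_cast at h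
  rw [Nat.add_sub_cancel, ← h]
  refine sum_congr rfl fun k _ => ?_
  rw [signedChoose, ← mul_assoc, ← mul_pow]
  simp

open Polynomial in
/-- The coefficient of `X ^ (2 m)` in `(X - 1) ^ (2 m) (X + 1) ^ (2 m) = (X ^ 2 - 1) ^ (2 m)`. -/
lemma sum_neg_one_pow_mul_choose_sq (m : ℕ) :
    ∑ k ∈ range (2 * m + 1), (-1 : ℚ) ^ k * ((2 * m).choose k : ℚ) ^ 2 =
      (-1) ^ m * ((2 * m).choose m : ℚ) := by
  have h : ((X + C (-1)) ^ (2 * m) * (X + C 1) ^ (2 * m) : ℚ[X]) =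
      expand ℚ 2 ((X + C (-1)) ^ (2 * m)) := by
    rw [map_pow, map_add, expand_X, expand_C, ← mul_pow]
    congr 1
    simp only [map_neg, map_one]
    ring
  have h1 := congrArg (fun f => coeff f (m * 2)) h
  simp only [coeff_expand_mul two_pos, coeff_mul, coeff_X_add_C_pow,
    one_pow, one_mul] at h1
  rw [mul_comm m 2, Nat.sum_antidiagonal_eq_sum_range_succ
    (fun i j => (-1 : ℚ) ^ (2 * m - i) * ((2 * m).choose i : ℚ) * ((2 * m).choose j : ℚ)),
    show 2 * m - m = m by omega] at h1
  rw [← h1]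
  refine sum_congr rfl fun k hk => ?_
  have hk := mem_range.1 hk
  rw [Nat.choose_symm (by omega)]
  have : (-1 : ℚ) ^ (2 * m - k) = (-1) ^ k := by
    rcases Nat.even_or_odd k with h | h
    · rw [h.neg_one_pow, Even.neg_one_pow]; rw [Nat.even_iff] at *; omega
    · rw [h.neg_one_pow, Odd.neg_one_pow]; rw [Nat.odd_iff] at *; omega
  rw [this]
  ring

lemma sum_signedChoose_sq {p m : ℕ} (hm : p = 2 * m + 1) :
    ∑ k ∈ range p, (-1 : ℚ) ^ k * signedChoose p k ^ 2 = signedChoose p m := by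
  subst hm
  rw [signedChoose, Nat.add_sub_cancel, ← sum_neg_one_pow_mul_choose_sq]
  refine sum_congr rfl fun k _ => ?_
  rw [signedChoose, mul_pow, ← pow_mul, mul_comm k 2, pow_mul]
  simp

/-! ### The central coefficient -/

/-- Writing `C(2m, m)` through the odd numbers `2m + 1 - 2j` gives a second product for the
central coefficient. -/
lemma signedChoose_half_eq {p m : ℕ} (hm : p = 2 * m + 1) :
    signedChoose p m =
      2 ^ (p - 1) * ∏ j ∈ range m, (1 - p * (2 * ((j + 1 : ℕ) : ℚ))⁻¹) := by
  have h1 : ∀ n : ℕ, (n.centralBinom : ℚ) * ∏ j ∈ range n, (2 * ((j + 1 : ℕ) : ℚ)) =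
      4 ^ n * ∏ i ∈ range n, (2 * (i : ℚ) + 1) := by
    intro n
    induction n with
    | zero => simp
    | succ n ih =>
      have := congrArg (Nat.cast : ℕ → ℚ) (Nat.succ_mul_centralBinom_succ n)
      push_cast at this
      rw [prod_range_succ, prod_range_succ, pow_succ]
      push_cast at ih ⊢
      linear_combination (2 * ∏ j ∈ range n, (2 * ((j : ℚ) + 1))) * this +
        4 * (2 * n + 1) * ih
  have h2 : ∏ i ∈ range m, (2 * (i : ℚ) + 1) =
      ∏ j ∈ range m, ((-1) * (1 - p * (2 * ((j + 1 : ℕ) : ℚ))⁻¹) * (2 * ((j + 1 : ℕ) : ℚ))) := by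
    rw [← prod_range_reflect]
    refine prod_congr rfl fun j hj => ?_
    have := mem_range.1 hj
    rw [hm, show m - 1 - j = m - (j + 1) by omega, Nat.cast_sub (by omega)]
    have : ((j + 1 : ℕ) : ℚ) ≠ 0 := by positivity
    field_simp
    push_cast
    ring
  have h3 := h1 m
  have h4 : ∏ j ∈ range m, (2 * ((j + 1 : ℕ) : ℚ)) ≠ 0 :=
    prod_ne_zero_iff.2 fun j _ => by positivity
  have h6 : ∏ j ∈ range m, ((-1) * (1 - p * (2 * ((j + 1 : ℕ) : ℚ))⁻¹)) =
      (-1) ^ m * ∏ j ∈ range m, (1 - p * (2 * ((j + 1 : ℕ) : ℚ))⁻¹) := by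
    rw [prod_mul_distrib, prod_const, card_range]
  rw [h2, prod_mul_distrib (g := fun j : ℕ => 2 * ((j + 1 : ℕ) : ℚ)), h6, ← mul_assoc] at h3
  have h5 := mul_right_cancel₀ h4 h3
  rw [signedChoose, show p - 1 = 2 * m by omega, ← Nat.centralBinom_eq_two_mul_choose, h5,
    pow_mul, ← mul_assoc, mul_left_comm, ← mul_assoc, ← mul_assoc, ← mul_pow]
  norm_num [← mul_pow]

lemma prod_one_add_sq_mul {p : ℕ} {ι : Type*} (s : Finset ι) (y : ι → ℚ)
    (hy : ∀ i ∈ s, y i ∈ pIntegral p) :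
    PCong p 4 (∏ i ∈ s, (1 + p ^ 2 * y i)) (1 + p ^ 2 * ∑ i ∈ s, y i) := by
  classical
  induction s using Finset.induction_on with
  | empty => exact PCong.of_eq (by simp)
  | insert a s ha ih =>
    obtain ⟨z, hz⟩ := ih fun i hi => hy i (mem_insert_of_mem hi)
    rw [prod_insert ha, sum_insert ha, eq_add_of_sub_eq hz]
    lift y a to pIntegral p using hy a (mem_insert_self a s) with b
    obtain ⟨c, hc⟩ : ∃ c : pIntegral p, (c : ℚ) = ∑ i ∈ s, y i :=
      ⟨⟨_, sum_mem fun i hi => hy i (mem_insert_of_mem hi)⟩, rfl⟩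
    refine ⟨z + b * c + p ^ 2 * b * z, ?_⟩
    rw [← hc]
    push_cast
    ring

lemma exists_two_pow_eq {p : ℕ} (hp : p.Prime) (hp2 : p ≠ 2) :
    ∃ k : pIntegral p, (2 : ℚ) ^ (p - 1) = 1 + p * k := by
  have := hp.two_le
  simpa using exists_pow_sub_one (j := 2) hp two_pos (by omega)

/-- Carlitz's refinement of Morley's congruence, with the Bernoulli number replaced by a harmonic
sum. -/
lemma signedChoose_half_mod {p m : ℕ} (hp : p.Prime) (hp5 : 5 ≤ p) (hm : p = 2 * m + 1) :
    PCong p 4 (signedChoose p m) ((2 ^ (p - 1)) ^ 2 - 1 / 24 * p ^ 3 * harm 3 m) := by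
  set y : ℕ → ℚ := fun j => -(((4 : ℕ) : ℚ)⁻¹ *
    (((j + 1 : ℕ) : ℚ)⁻¹ * ((p - (j + 1) : ℕ) : ℚ)⁻¹)) with hy
  have hx : signedChoose p m = (2 ^ (p - 1)) ^ 2 * ∏ j ∈ range m, (1 + p ^ 2 * y j) := by
    -- The square of the second product equals the first one times `∏ (1 + p ^ 2 * y j)`.
    have h1 : (∏ j ∈ range m, (1 - p * (2 * ((j + 1 : ℕ) : ℚ))⁻¹)) ^ 2 =
        signedChoose p m * ∏ j ∈ range m, (1 + p ^ 2 * y j) := by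
      rw [signedChoose_eq_prod (by omega), ← prod_mul_distrib, ← prod_pow]
      refine prod_congr rfl fun j hj => ?_
      have hj := mem_range.1 hj
      have h2 : ((p - (j + 1) : ℕ) : ℚ) ≠ 0 := by
        rw [Nat.cast_ne_zero]; omega
      have h3 : (p : ℚ) = ((j + 1 : ℕ) : ℚ) + ((p - (j + 1) : ℕ) : ℚ) := by
        rw [← Nat.cast_add]; congr 1; omega
      have h4 : ((j + 1 : ℕ) : ℚ) ≠ 0 := by positivity
      rw [hy, h3]
      dsimp only
      field_simp
      push_cast
      ring
    have h2 := signedChoose_half_eq hm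
    apply mul_left_cancel₀ (signedChoose_ne_zero (p := p) (k := m) (by omega))
    nth_rw 1 2 [h2]
    linear_combination (2 ^ (p - 1)) ^ 2 * h1
  have hyI : ∀ j ∈ range m, y j ∈ pIntegral p := fun j hj => by
    have := mem_range.1 hj
    exact neg_mem (mul_mem (inv_mem_pIntegral_of_lt hp (by omega) (by omega))
      (mul_mem (inv_mem_pIntegral_of_lt hp (by omega) (by omega))
        (inv_mem_pIntegral_of_lt hp (by omega) (by omega))))
  have hsum : PCong p 2 (∑ j ∈ range m, y j) (1 / 4 * (harm 2 m + p * harm 3 m)) := by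
    have h1 : 1 / 4 * (harm 2 m + p * harm 3 m) = ∑ j ∈ range m, -(((4 : ℕ) : ℚ)⁻¹ *
        ((j + 1 : ℕ) : ℚ)⁻¹) * (-((j + 1 : ℕ) : ℚ)⁻¹ - p * ((j + 1 : ℕ) : ℚ)⁻¹ ^ 2) := by
      rw [harm, harm, mul_sum, ← sum_add_distrib, mul_sum]
      exact sum_congr rfl fun j _ => by push_cast; ring
    rw [h1]
    refine PCong.sum fun j hj => ?_
    have := mem_range.1 hj
    have h2 := (inv_reflect hp (by omega : 0 < j + 1) (by omega)).mul_left
      ⟨_, neg_mem (mul_mem (inv_mem_pIntegral_of_lt (j := 4) hp (by omega) (by omega))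
        (inv_mem_pIntegral_of_lt hp (by omega : 0 < j + 1) (by omega)))⟩
    exact (PCong.of_eq (by rw [hy]; ring)).trans h2
  obtain ⟨a, ha⟩ := prod_one_add_sq_mul (range m) y hyI
  obtain ⟨b, hb⟩ := hsum
  obtain ⟨c, hc⟩ := harm_two_half hp hp5 hm
  obtain ⟨k, hk⟩ := exists_two_pow_eq hp (by omega)
  obtain ⟨s, hs⟩ := exists_coe_eq_inv (j := 2) hp (by omega) (by omega)
  obtain ⟨t, ht⟩ := exists_coe_eq_inv (j := 3) hp (by omega) (by omega)
  lift harm 3 m to pIntegral p using harm_mem_pIntegral hp 3 (by omega) with h3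
  have hprod : ∏ j ∈ range m, (1 + p ^ 2 * y j) =
      1 - 1 / 24 * (p : ℚ) ^ 3 * h3 + (p : ℚ) ^ 4 * ((a : ℚ) + b + 1 / 4 * (c : ℚ)) := by
    linear_combination ha + (p : ℚ) ^ 2 * hb + (p : ℚ) ^ 2 / 4 * hc
  rw [hx, hprod, hk]
  refine ⟨(1 + p * k) ^ 2 * (a + b + s ^ 2 * c) - (2 * k + p * k ^ 2) * s ^ 3 * t * h3, ?_⟩
  push_cast at hs ht ⊢
  rw [hs, ht]
  ring

/-! ### Reciprocals of binomial coefficients -/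

/-- The sum `∑_{i = 1}^{n} 2 ^ i / i`. -/
def twoPowSum (n : ℕ) : ℚ := ∑ i ∈ range n, 2 ^ (i + 1) * ((i + 1 : ℕ) : ℚ)⁻¹

lemma twoPowSum_succ (n : ℕ) :
    twoPowSum (n + 1) = twoPowSum n + 2 ^ (n + 1) * ((n + 1 : ℕ) : ℚ)⁻¹ :=
  sum_range_succ _ _

lemma inv_choose_add_inv_choose {n k : ℕ} (hk : k ≤ n) :
    ((n + 1).choose k : ℚ)⁻¹ + ((n + 1).choose (k + 1) : ℚ)⁻¹ =
      (n + 2) / (n + 1) * (n.choose k : ℚ)⁻¹ := by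
  have h1 := congrArg (Nat.cast : ℕ → ℚ) (Nat.add_one_mul_choose_eq n k)
  have h2 := congrArg (Nat.cast : ℕ → ℚ) (Nat.choose_mul_succ_eq n k)
  rw [Nat.cast_mul, Nat.cast_mul, Nat.cast_sub (by omega)] at h2
  have c1 : ((n + 1).choose k : ℚ) ≠ 0 := Nat.cast_ne_zero.2 (Nat.choose_pos (by omega)).ne'
  have c2 : ((n + 1).choose (k + 1) : ℚ) ≠ 0 :=
    Nat.cast_ne_zero.2 (Nat.choose_pos (by omega)).ne'
  have c3 : (n.choose k : ℚ) ≠ 0 := Nat.cast_ne_zero.2 (Nat.choose_pos hk).ne'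
  have c4 : (n : ℚ) + 1 ≠ 0 := by positivity
  push_cast at h1 h2
  have e1 : ((n + 1).choose k : ℚ)⁻¹ = (n + 1 - k) / (n + 1) * (n.choose k : ℚ)⁻¹ := by
    field_simp
    linear_combination h2
  have e2 : ((n + 1).choose (k + 1) : ℚ)⁻¹ = (k + 1) / (n + 1) * (n.choose k : ℚ)⁻¹ := by
    field_simp
    linear_combination h1
  rw [e1, e2]
  field_simp
  ring

/-- The sum of the reciprocals of the binomial coefficients `C(n, k)`, by the recursion that
follows from `inv_choose_add_inv_choose`. -/
lemma two_pow_mul_sum_inv_choose (n : ℕ) :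
    2 ^ (n + 1) * ∑ k ∈ range (n + 1), (n.choose k : ℚ)⁻¹ = (n + 1) * twoPowSum (n + 1) := by
  induction n with
  | zero => simp [twoPowSum]
  | succ n ih =>
    have h : 2 * ∑ k ∈ range (n + 2), ((n + 1).choose k : ℚ)⁻¹ =
        2 + (n + 2) / (n + 1) * ∑ k ∈ range (n + 1), (n.choose k : ℚ)⁻¹ := by
      rw [mul_sum (range (n + 1)), ← sum_congr rfl fun k hk =>
        inv_choose_add_inv_choose (Nat.lt_succ_iff.1 (mem_range.1 hk)), sum_add_distrib]
      have e1 := sum_range_succ (fun k => ((n + 1).choose k : ℚ)⁻¹) (n + 1)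
      have e2 := sum_range_succ' (fun k => ((n + 1).choose k : ℚ)⁻¹) (n + 1)
      simp only [Nat.choose_self, Nat.choose_zero_right, Nat.cast_one, inv_one] at e1 e2
      linear_combination e1 + e2
    rw [twoPowSum_succ, pow_succ, mul_assoc, h, mul_add, mul_left_comm, ih]
    push_cast
    field_simp
    ring

/-- The binomial identity `∑_{i ≤ n} (2 ^ i - 1) / i = ∑_{1 ≤ k ≤ n} C(n, k) / k`. -/
lemma twoPowSum_sub_harm (n : ℕ) :
    twoPowSum n - harm 1 n = ∑ k ∈ range n, (n.choose (k + 1) : ℚ) * ((k + 1 : ℕ) : ℚ)⁻¹ := by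
  induction n with
  | zero => simp [twoPowSum, harm]
  | succ n ih =>
    have h1 : ∑ k ∈ range (n + 1), (n.choose k : ℚ) * ((k + 1 : ℕ) : ℚ)⁻¹ =
        (2 ^ (n + 1) - 1) * ((n + 1 : ℕ) : ℚ)⁻¹ := by
      have h2 := congrArg (Nat.cast : ℕ → ℚ) (Nat.sum_range_choose (n + 1))
      rw [sum_range_succ'] at h2
      push_cast at h2
      rw [← h2]
      simp only [Nat.choose_zero_right, Nat.cast_one, add_sub_cancel_right, sum_mul]
      refine sum_congr rfl fun k _ => ?_
      have h3 := congrArg (Nat.cast : ℕ → ℚ) (Nat.add_one_mul_choose_eq n k)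
      push_cast at h3 ⊢
      field_simp
      linear_combination h3
    have h2 : ∑ k ∈ range (n + 1), ((n + 1).choose (k + 1) : ℚ) * ((k + 1 : ℕ) : ℚ)⁻¹ =
        ∑ k ∈ range (n + 1), (n.choose k : ℚ) * ((k + 1 : ℕ) : ℚ)⁻¹ +
          ∑ k ∈ range n, (n.choose (k + 1) : ℚ) * ((k + 1 : ℕ) : ℚ)⁻¹ := by
      simp only [Nat.choose_succ_succ, Nat.cast_add, add_mul, sum_add_distrib]
      congr 1
      rw [sum_range_succ]
      simp
    rw [h2, h1, ← ih, twoPowSum_succ, harm_succ]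
    ring

/-- Summing `C(p, k) / k = -p (-1) ^ k c_{k-1} / k ^ 2` with `c_{k-1} ≡ 1 - p H_{k-1}` modulo `p ^ 2`
expresses `p ∑_{i < p} 2 ^ i / i` through harmonic sums. -/
lemma mul_twoPowSum_mod {p m : ℕ} (hp : p.Prime) (hp5 : 5 ≤ p) (hm : p = 2 * m + 1) :
    PCong p 4 (p * twoPowSum (p - 1))
      (-2 * (2 ^ (p - 1) - 1) + 7 / 24 * p ^ 3 * harm 3 m) := by
  have hp0 : (p : ℚ) ≠ 0 := by exact_mod_cast hp.ne_zero
  have h1 : p * twoPowSum (p - 1) = p * harm 1 (2 * m) + 2 - 2 * 2 ^ (p - 1) +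
      p ^ 2 * ∑ k ∈ range (2 * m), (-1) ^ k * ((k + 1 : ℕ) : ℚ)⁻¹ ^ 2 * signedChoose p k := by
    have h := twoPowSum_sub_harm (2 * m + 1)
    rw [twoPowSum_succ, harm_succ, sum_range_succ, Nat.choose_self, ← hm] at h
    have h2 : ∑ k ∈ range (2 * m), (p.choose (k + 1) : ℚ) * ((k + 1 : ℕ) : ℚ)⁻¹ =
        p * ∑ k ∈ range (2 * m), (-1) ^ k * ((k + 1 : ℕ) : ℚ)⁻¹ ^ 2 * signedChoose p k := by
      rw [mul_sum]
      refine sum_congr rfl fun k _ => ?_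
      have h3 := congrArg (Nat.cast : ℕ → ℚ) (Nat.add_one_mul_choose_eq (p - 1) k)
      rw [show p - 1 + 1 = p by omega, Nat.cast_mul, Nat.cast_mul] at h3
      have h4 : ((k + 1 : ℕ) : ℚ) ≠ 0 := by positivity
      have h5 : ((-1 : ℚ) ^ k) * (-1) ^ k = 1 := by rw [← mul_pow]; simp
      rw [signedChoose]
      field_simp
      linear_combination -h3 - p * ((p - 1).choose k : ℚ) * h5
    rw [h2] at h
    have h6 : (2 : ℚ) ^ p = 2 * 2 ^ (p - 1) := by
      rw [← pow_succ', show p - 1 + 1 = p by omega]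
    rw [h6] at h
    rw [show p - 1 = 2 * m by omega] at h ⊢
    generalize ∑ k ∈ range (2 * m), (-1) ^ k * ((k + 1 : ℕ) : ℚ)⁻¹ ^ 2 * signedChoose p k = S at h ⊢
    field_simp at h
    push_cast at h
    linear_combination h
  have h2 : PCong p 2 (∑ k ∈ range (2 * m), (-1) ^ k * ((k + 1 : ℕ) : ℚ)⁻¹ ^ 2 * signedChoose p k)
      (harm 2 (2 * m) - 1 / 2 * harm 2 m + p * ∑ k ∈ range (2 * m),
        (-1 : ℚ) ^ (k + 1) * ((k + 1 : ℕ) : ℚ)⁻¹ ^ 2 * harm 1 k) := by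
    have h3 := alternating_harm 2 m
    have h4 : harm 2 (2 * m) - 1 / 2 * harm 2 m + p * ∑ k ∈ range (2 * m),
        (-1 : ℚ) ^ (k + 1) * ((k + 1 : ℕ) : ℚ)⁻¹ ^ 2 * harm 1 k = ∑ k ∈ range (2 * m),
        (-1) ^ k * ((k + 1 : ℕ) : ℚ)⁻¹ ^ 2 * (1 - p * harm 1 k) := by
      have h5 : harm 2 (2 * m) - 1 / 2 * harm 2 m =
          -∑ j ∈ range (2 * m), (-1 : ℚ) ^ (j + 1) * ((j + 1 : ℕ) : ℚ)⁻¹ ^ 2 := by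
        rw [h3]; ring
      rw [h5, ← sum_neg_distrib, mul_sum, ← sum_add_distrib]
      exact sum_congr rfl fun k _ => by ring
    rw [h4]
    refine PCong.sum fun k hk => ?_
    have hk := mem_range.1 hk
    exact (signedChoose_mod hp (by omega)).mul_left ⟨_, mul_mem
      (pow_mem (neg_mem (one_mem _)) k)
      (pow_mem (inv_mem_pIntegral_of_lt hp (by omega : 0 < k + 1) (by omega)) 2)⟩
  obtain ⟨a, ha⟩ := h2
  obtain ⟨b, hb⟩ := alternating_harm_harm hp hp5 hm
  obtain ⟨c, hc⟩ := harm_two_half hp hp5 hm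
  obtain ⟨d, hd⟩ := harm_two_full hp hp5 hm
  obtain ⟨e, he⟩ := harm_one_full hp hp5 hm
  obtain ⟨t, ht⟩ := exists_coe_eq_inv (j := 2) hp (by omega) (by omega)
  refine ⟨a + b + d - t * c + e, ?_⟩
  push_cast at ht ⊢
  rw [ht]
  linear_combination h1 + (p : ℚ) ^ 2 * ha + (p : ℚ) ^ 3 * hb + (p : ℚ) ^ 2 * hd -
    (p : ℚ) ^ 2 / 2 * hc + p * he

/-! ### Alternating moments of `1 - signedChoose` -/

/-- The alternating moments `∑_k (-1) ^ k (1 - c_k) ^ i` of the deviations of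
`c_k = (-1) ^ k * C(p - 1, k)` from `1`. -/
def moment (p i : ℕ) : ℚ := ∑ k ∈ range p, (-1) ^ k * (1 - signedChoose p k) ^ i

lemma moment_zero {p m : ℕ} (hm : p = 2 * m + 1) : moment p 0 = 1 := by
  subst hm
  simp [moment]

lemma moment_one {p m : ℕ} (hm : p = 2 * m + 1) : moment p 1 = 1 - 2 ^ (p - 1) := by
  rw [← moment_zero hm, ← sum_signedChoose (p := p) (by omega), moment, moment, ← sum_sub_distrib]
  exact sum_congr rfl fun k _ => by ring

lemma moment_two {p m : ℕ} (hp : p.Prime) (hp5 : 5 ≤ p) (hm : p = 2 * m + 1) :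
    PCong p 4 (moment p 2) ((2 ^ (p - 1) - 1) ^ 2 - 1 / 24 * p ^ 3 * harm 3 m) := by
  have h : moment p 2 = 1 - 2 * 2 ^ (p - 1) + signedChoose p m := by
    rw [← moment_zero hm, ← sum_signedChoose (p := p) (by omega), ← sum_signedChoose_sq hm,
      moment, moment, mul_sum, ← sum_sub_distrib, ← sum_add_distrib]
    exact sum_congr rfl fun k _ => by ring
  obtain ⟨a, ha⟩ := signedChoose_half_mod hp hp5 hm
  exact ⟨a, by rw [h]; linear_combination ha⟩

/-- The sum of the reciprocals `1 / C(p - 1, k)` in terms of the first moments, by expanding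
`1 / c_k = 1 / (1 - (1 - c_k))`. -/
lemma sum_inv_choose_mod {p m : ℕ} (hp : p.Prime) (hm : p = 2 * m + 1) :
    PCong p 4 (∑ k ∈ range p, ((p - 1).choose k : ℚ)⁻¹)
      (1 + moment p 1 + moment p 2 + moment p 3) := by
  rw [← moment_zero hm, moment, moment, moment, moment, ← sum_add_distrib,
    ← sum_add_distrib, ← sum_add_distrib]
  refine PCong.sum fun k hk => ?_
  have hk := mem_range.1 hk
  obtain ⟨z, hz⟩ := exists_signedChoose_eq hp hk
  have h0 := signedChoose_ne_zero hk
  have h2 : ((p - 1).choose k : ℚ)⁻¹ = (-1) ^ k * (signedChoose p k)⁻¹ := by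
    rw [signedChoose, mul_inv, ← inv_pow, ← mul_assoc, ← mul_pow]
    norm_num
  obtain ⟨w, hw⟩ : ∃ w : pIntegral p, (w : ℚ) = (signedChoose p k)⁻¹ :=
    ⟨⟨_, signedChoose_inv_mem_pIntegral hp hk⟩, rfl⟩
  refine ⟨(-1) ^ k * (z ^ 4 * w), ?_⟩
  rw [h2]
  push_cast
  rw [hw]
  have h3 : (p : ℚ) * z = signedChoose p k - 1 := by rw [hz]; ring
  have h4 : (p : ℚ) ^ 4 * ((-1) ^ k * ((z : ℚ) ^ 4 * (signedChoose p k)⁻¹)) =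
      (-1) ^ k * ((signedChoose p k - 1) ^ 4 * (signedChoose p k)⁻¹) := by
    rw [← h3]; ring
  rw [h4]
  field_simp
  ring

/-- The third moment comes from comparing the expansion `sum_inv_choose_mod` with the closed form
of the sum of reciprocals. -/
lemma moment_three {p m : ℕ} (hp : p.Prime) (hp5 : 5 ≤ p) (hm : p = 2 * m + 1) :
    PCong p 4 (moment p 3) (-(2 ^ (p - 1) - 1) ^ 3 + 3 / 16 * p ^ 3 * harm 3 m) := by
  obtain ⟨a, ha⟩ := sum_inv_choose_mod hp hm
  obtain ⟨b, hb⟩ := moment_two hp hp5 hm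
  obtain ⟨c, hc⟩ := mul_twoPowSum_mod hp hp5 hm
  obtain ⟨k, hk⟩ := exists_two_pow_eq hp (by omega)
  obtain ⟨s, hs⟩ := exists_coe_eq_inv (j := 2) hp (by omega) (by omega)
  obtain ⟨t, ht⟩ := exists_coe_eq_inv (j := 3) hp (by omega) (by omega)
  have hQ0 : (2 : ℚ) ^ (p - 1) ≠ 0 := by positivity
  have hQ : ((2 : ℚ) ^ (p - 1))⁻¹ ∈ pIntegral p := by
    rw [← inv_pow]
    refine pow_mem ?_ _
    have := s.2
    rw [hs] at this
    exact_mod_cast this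
  obtain ⟨w, hw⟩ : ∃ w : pIntegral p, (w : ℚ) = ((2 : ℚ) ^ (p - 1))⁻¹ := ⟨⟨_, hQ⟩, rfl⟩
  have h1 : 2 * 2 ^ (p - 1) * (∑ k ∈ range p, ((p - 1).choose k : ℚ)⁻¹ - 1) =
      p * twoPowSum (p - 1) := by
    have h := two_pow_mul_sum_inv_choose (p - 1)
    have hp0 : (p : ℚ) ≠ 0 := by exact_mod_cast hp.ne_zero
    rw [twoPowSum_succ, show p - 1 + 1 = p by omega, Nat.cast_sub hp.one_le] at h
    have h6 : (2 : ℚ) ^ p = 2 * 2 ^ (p - 1) := by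
      rw [← pow_succ', show p - 1 + 1 = p by omega]
    rw [h6] at h
    generalize ∑ k ∈ range p, ((p - 1).choose k : ℚ)⁻¹ = S at h ⊢
    generalize (2 : ℚ) ^ (p - 1) = Q at h ⊢
    push_cast at h
    linear_combination h + 2 * Q * mul_inv_cancel₀ hp0
  have h3 : PCong p 4 (∑ k ∈ range p, ((p - 1).choose k : ℚ)⁻¹)
      (1 - (2 ^ (p - 1) - 1) + (2 ^ (p - 1) - 1) ^ 2 - (2 ^ (p - 1) - 1) ^ 3 +
        7 / 48 * p ^ 3 * harm 3 m) := by
    lift harm 3 m to pIntegral p using harm_mem_pIntegral hp 3 (by omega) with h3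
    -- With `Q = 1 + r`, `1 - r / Q ≡ 1 - r + r ^ 2 - r ^ 3`; the error is `r ^ 4 / Q`.
    refine ⟨w * (k ^ 4 + s * c - 7 * s ^ 4 * t * k * h3), ?_⟩
    push_cast at hs ht ⊢
    rw [hs, ht, hw]
    apply mul_left_cancel₀ hQ0
    have e := mul_inv_cancel₀ hQ0
    rw [hk] at e h1 hc ⊢
    linear_combination h1 / 2 + hc / 2 - (p : ℚ) ^ 4 *
      (k ^ 4 + 2⁻¹ * c - 7 * 2⁻¹ ^ 4 * 3⁻¹ * k * h3) * e
  obtain ⟨d, hd⟩ := h3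
  refine ⟨d - a - b, ?_⟩
  push_cast
  have h0 := moment_one hm
  linear_combination hd - ha - hb - h0

/-! ### Powers -/

/-- The binomial expansion of `(1 + x) ^ a` for `x` divisible by `p`, modulo `p ^ 4`. -/
lemma one_add_pow_mod {p : ℕ} (z : pIntegral p) (a : ℕ) :
    PCong p 4 ((1 + p * z) ^ a) (1 + a * (p * z) + a.choose 2 * (p * z) ^ 2 +
      a.choose 3 * (p * z) ^ 3) := by
  induction a with
  | zero => exact PCong.of_eq (by simp)
  | succ a ih =>
    obtain ⟨w, hw⟩ := ih
    have h2 : (a + 1).choose 2 = a + a.choose 2 := by simp [Nat.choose_succ_succ' a 1]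
    have h3 : (a + 1).choose 3 = a.choose 2 + a.choose 3 := Nat.choose_succ_succ' a 2
    refine ⟨(1 + p * z) * w + a.choose 3 * z ^ 4, ?_⟩
    rw [pow_succ, eq_add_of_sub_eq hw, h2, h3]
    push_cast
    ring

lemma cast_choose_three (a : ℕ) : (a.choose 3 : ℚ) = a * (a - 1) * (a - 2) / 6 := by
  induction a with
  | zero => simp
  | succ a ih =>
    rw [Nat.choose_succ_succ' a 2, Nat.cast_add, Nat.cast_choose_two, ih]
    push_cast
    ring

lemma sum_choose_pow_eq (p : ℕ) {a : ℕ} (ha : 0 < a) :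
    ∑ k ∈ range p, (-1 : ℚ) ^ ((a - 1) * k) * ((p - 1).choose k : ℚ) ^ a =
      ∑ k ∈ range p, (-1) ^ k * signedChoose p k ^ a := by
  obtain ⟨b, rfl⟩ : ∃ b, a = b + 1 := ⟨a - 1, by omega⟩
  refine sum_congr rfl fun k _ => ?_
  have h : ((-1 : ℚ) ^ k) * (-1) ^ k = 1 := by rw [← mul_pow]; simp
  rw [signedChoose, mul_pow, Nat.add_sub_cancel, ← pow_mul, mul_add_one, pow_add, mul_comm b]
  linear_combination -(-1 : ℚ) ^ (k * b) * ((p - 1).choose k : ℚ) ^ (b + 1) * h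

lemma sum_signedChoose_pow_mod {p m : ℕ} (hp : p.Prime) (hm : p = 2 * m + 1) (a : ℕ) :
    PCong p 4 (∑ k ∈ range p, (-1) ^ k * signedChoose p k ^ a)
      (1 - a * moment p 1 + a.choose 2 * moment p 2 - a.choose 3 * moment p 3) := by
  conv =>
    arg 4
    rw [← moment_zero hm, moment, moment, moment, moment, mul_sum, mul_sum, mul_sum,
      ← sum_sub_distrib, ← sum_add_distrib, ← sum_sub_distrib]
  refine PCong.sum fun k hk => ?_
  obtain ⟨z, hz⟩ := exists_signedChoose_eq hp (mem_range.1 hk)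
  have h := (one_add_pow_mod z a).mul_left ((-1) ^ k)
  rw [hz]
  refine (PCong.of_eq ?_).trans (h.trans (PCong.of_eq ?_)) <;> push_cast <;> ring

theorem theorem1p1 (p a : ℕ) (hp : p.Prime) (hp2 : p ≠ 2) (ha : 0 < a) :
    RatModEq (p ^ 4)
      (∑ k ∈ Finset.range p, (-1 : ℚ) ^ ((a - 1) * k) * ((p - 1).choose k : ℚ) ^ a)
      ((2 : ℚ) ^ (a * (p - 1)) +
        (a : ℚ) * ((a : ℚ) - 1) * (3 * (a : ℚ) - 4) / 48 * (p : ℚ) ^ 3 * bernoulli (p - 3)) := by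
  apply RatModEq.of_pCong
  obtain ⟨m, hm⟩ := hp.odd_of_ne_two hp2
  rw [sum_choose_pow_eq p ha, mul_comm a, pow_mul]
  obtain ⟨z, hz⟩ := exists_two_pow_eq hp hp2
  obtain ⟨u, hu⟩ := one_add_pow_mod z a
  obtain ⟨v, hv⟩ := sum_signedChoose_pow_mod hp hm a
  have hc2 := Nat.cast_choose_two ℚ a
  have hc3 := cast_choose_three a
  rw [moment_one hm] at hv
  rw [hz] at hv ⊢
  rcases (show p = 3 ∨ 5 ≤ p by have := hp.two_le; omega) with h3 | h5
  · -- Here the moments are computed by hand; the remaining difference of cubic polynomials in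
    -- `a` is `3 ^ 4 / 8 * (C(a, 3) + 2 * C(a, 2))`.
    subst h3
    have h8 : (((8 : ℕ) : ℚ))⁻¹ ∈ pIntegral 3 := natCast_inv_mem_pIntegral (by norm_num)
    obtain ⟨t, ht⟩ : ∃ t : pIntegral 3, (t : ℚ) = ((8 : ℕ) : ℚ)⁻¹ := ⟨⟨_, h8⟩, rfl⟩
    have hm2 : moment 3 2 = -9 := by norm_num [moment, sum_range_succ, signedChoose]
    have hm3 : moment 3 3 = -27 := by norm_num [moment, sum_range_succ, signedChoose]
    have hz1 : (z : ℚ) = 1 := by norm_num at hz; linarith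
    rw [hm2, hm3, hz1] at hv
    rw [hz1] at hu ⊢
    refine ⟨v - u - t * (a.choose 3 + 2 * a.choose 2), ?_⟩
    simp only [Nat.sub_self, bernoulli_zero]
    push_cast at hu hv ht ⊢
    rw [ht]
    rw [hc2, hc3] at hu hv
    rw [hc2, hc3]
    linear_combination hv - hu
  · obtain ⟨b, hb⟩ := moment_two hp h5 hm
    obtain ⟨c, hc⟩ := moment_three hp h5 hm
    obtain ⟨d, hd⟩ := harm_three_half hp h5 hm
    obtain ⟨s, hs⟩ := exists_coe_eq_inv (j := 2) hp (by omega) (by omega)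
    obtain ⟨t, ht⟩ := exists_coe_eq_inv (j := 3) hp (by omega) (by omega)
    rw [hz] at hb hc
    refine ⟨v - u + a.choose 2 * (b - s ^ 3 * t * d) - a.choose 3 * (c + 3 * s ^ 4 * d), ?_⟩
    push_cast at hs ht ⊢
    rw [hs, ht]
    rw [hc2, hc3] at hu hv
    rw [hc2, hc3]
    linear_combination hv - hu + (a : ℚ) * (a - 1) / 2 * hb - (a : ℚ) * (a - 1) * (a - 2) / 6 * hc +
      (-(a : ℚ) * (a - 1) / 48 - (a : ℚ) * (a - 1) * (a - 2) / 32) * p ^ 3 * hd
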